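/- Let $\mathcal M$ be a (Hausdorff, finite-dimensional) smooth manifold with an almost contact structure $(\varphi,\xi,\eta)$, i.e. an endomorphism field $\varphi$, a vector field $\xi$ and a 1-form $\eta$ with $\varphi^2=-I+\xi\otimes\eta$, $\varphi\xi=0$, $\eta\circ\varphi=0$, $\eta(\xi)=1$, and let $g$ be a pseudo-Riemannian metric with $g(\varphi x,\varphi y)=g(x,y)+\eta(x)\eta(y)$ for all vector fields $x,y$ (so that $\eta=-g(\xi,\cdot)$). Let $\nabla$ be the Levi-Civita connection of $g$, $F(x,y,z)=g((\nabla_x\varphi)y,z)$, $d\eta(x,y)=(\nabla_x\eta)y-(\nabla_y\eta)x$, and let $\mathfrak L_\xi g$ be the Lie derivative of $g$ along $\xi$. Put $\{x,y\}=\nabla_xy+\nabla_yx$ and $$[\varphi,\varphi](x,y)=\varphi^2[x,y]+[\varphi x,\varphi y]-\varphi[\varphi x,y]-\varphi[x,\varphi y],\qquad N=[\varphi,\varphi]+\xi\otimes d\eta,$$ $$\{\varphi,\varphi\}(x,y)=\varphi^2\{x,y\}+\{\varphi x,\varphi y\}-\varphi\{\varphi x,y\}-\varphi\{x,\varphi y\},\qquad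 \widehat N=\{\varphi,\varphi\}-\xi\otimes\mathfrak L_\xi g.$$ Then the following statements are equivalent: (i) $F(\varphi x,y,z)+F(\varphi y,x,z)+F(x,y,\varphi z)+F(y,x,\varphi z)=0$ for all vector fields $x,y,z$; (ii) $\widehat N=0$ and $\xi$ is a Killing vector field; (iii) $\{\varphi,\varphi\}=0$ and $\xi$ is a Killing vector field; (iv) the tensor $N(x,y,z)=g(N(x,y),z)$ is a 3-form and $\xi$ is a Killing vector field; (v) there exists exactly one linear connection $D$ with $D\varphi=D\xi=D\eta=Dg=0$ whose torsion $T(x,y,z)=g(D_xy-D_yx-[x,y],z)$ is totally skew-symmetric. -/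

import Mathlib

open scoped Manifold ContDiff Bundle

namespace PseudoRiemannian

section Fields

/-- Smooth vector fields on `M`, i.e. smooth sections of the tangent bundle. -/
abbrev 𝔛 (E M : Type*) [NormedAddCommGroup E] [NormedSpace ℝ E] [TopologicalSpace M]
    [ChartedSpace E M] [IsManifold 𝓘(ℝ, E) ∞ M] : Type _ :=
  Cₛ^∞⟮𝓘(ℝ, E); E, fun p : M => TangentSpace 𝓘(ℝ, E) p⟯

/-- Smooth sections of the bundle of endomorphisms of the tangent spaces. -/
abbrev EndField (E M : Type*) [NormedAddCommGroup E] [NormedSpace ℝ E] [TopologicalSpace M]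
    [ChartedSpace E M] [IsManifold 𝓘(ℝ, E) ∞ M] : Type _ :=
  Cₛ^∞⟮𝓘(ℝ, E); E →L[ℝ] E,
    fun p : M => TangentSpace 𝓘(ℝ, E) p →L[ℝ] TangentSpace 𝓘(ℝ, E) p⟯

/-- Smooth 1-forms on `M`. -/
abbrev OneForm (E M : Type*) [NormedAddCommGroup E] [NormedSpace ℝ E] [TopologicalSpace M]
    [ChartedSpace E M] [IsManifold 𝓘(ℝ, E) ∞ M] : Type _ :=
  Cₛ^∞⟮𝓘(ℝ, E); E →L[ℝ] ℝ, fun p : M => TangentSpace 𝓘(ℝ, E) p →L[ℝ] ℝ⟯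

/-- A smooth pseudo-Riemannian metric on `M` (of arbitrary signature). -/
structure Metric (E M : Type*) [NormedAddCommGroup E] [NormedSpace ℝ E] [TopologicalSpace M]
    [ChartedSpace E M] [IsManifold 𝓘(ℝ, E) ∞ M] where
  /-- the scalar product on each tangent space -/
  val (p : M) : TangentSpace 𝓘(ℝ, E) p →L[ℝ] TangentSpace 𝓘(ℝ, E) p →L[ℝ] ℝ
  symm (p : M) (u v : TangentSpace 𝓘(ℝ, E) p) : val p u v = val p v u
  nondegenerate (p : M) (u : TangentSpace 𝓘(ℝ, E) p) (hu : ∀ v, val p u v = 0) : u = 0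
  contMDiff : ContMDiff 𝓘(ℝ, E) (𝓘(ℝ, E).prod 𝓘(ℝ, E →L[ℝ] E →L[ℝ] ℝ)) ∞
    (fun p => Bundle.TotalSpace.mk' (E →L[ℝ] E →L[ℝ] ℝ)
      (E := fun p : M => TangentSpace 𝓘(ℝ, E) p →L[ℝ] TangentSpace 𝓘(ℝ, E) p →L[ℝ] ℝ) p (val p))

variable {E M : Type*} [NormedAddCommGroup E] [NormedSpace ℝ E] [TopologicalSpace M]
  [ChartedSpace E M] [IsManifold 𝓘(ℝ, E) ∞ M]

/-- The function `g(x, y)` on `M`. -/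
noncomputable def Metric.app (g : Metric E M) (x y : 𝔛 E M) : M → ℝ := fun p => g.val p (x p) (y p)

/-- The vector field `φ x`. -/
noncomputable def EndField.app (φ : EndField E M) (x : 𝔛 E M) : 𝔛 E M where
  toFun p := φ p (x p)
  contMDiff_toFun := φ.contMDiff.clm_bundle_apply x.contMDiff

/-- The function `η(x)` on `M`. -/
noncomputable def OneForm.app (η : OneForm E M) (x : 𝔛 E M) : M → ℝ := fun p => η p (x p)

/-- The derivative `x f` of a function `f` along the vector field `x`. -/
noncomputable def dir (x : 𝔛 E M) (f : M → ℝ) : M → ℝ := fun p => mvfderiv 𝓘(ℝ, E) f p (x p)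

/-- The product `f x` of a smooth function and a vector field. -/
noncomputable def fmul (f : C^∞⟮𝓘(ℝ, E), M; ℝ⟯) (x : 𝔛 E M) : 𝔛 E M where
  toFun p := f p • x p
  contMDiff_toFun := f.contMDiff.smul_section x.contMDiff

/-- The Lie bracket `[x, y]`. -/
noncomputable def lie [FiniteDimensional ℝ E] (x y : 𝔛 E M) : 𝔛 E M where
  toFun := VectorField.mlieBracket 𝓘(ℝ, E) x y
  contMDiff_toFun := by
    intro p
    have : IsManifold 𝓘(ℝ, E) (minSmoothness ℝ 2) M := by
      simpa using (inferInstance : IsManifold 𝓘(ℝ, E) 2 M)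
    have : IsManifold 𝓘(ℝ, E) ((((⊤ : ℕ∞) : WithTop ℕ∞)) + 1) M := by
      simpa using (inferInstance : IsManifold 𝓘(ℝ, E) ∞ M)
    exact ContMDiffAt.mlieBracket_vectorField (n := ⊤) (m := ⊤) (x.contMDiff p) (y.contMDiff p)
      (by simp)

end Fields

/-- A linear connection on `M`, as an operator `D` taking `x`, `y` to the vector field `D_x y`. -/
@[ext]
structure LinearConnection (E M : Type*) [NormedAddCommGroup E] [NormedSpace ℝ E]
    [TopologicalSpace M] [ChartedSpace E M] [IsManifold 𝓘(ℝ, E) ∞ M] where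
  /-- the vector field `D_x y` -/
  D : 𝔛 E M → 𝔛 E M → 𝔛 E M
  add_left (x x' y : 𝔛 E M) : D (x + x') y = D x y + D x' y
  fmul_left (f : C^∞⟮𝓘(ℝ, E), M; ℝ⟯) (x y : 𝔛 E M) : D (fmul f x) y = fmul f (D x y)
  add_right (x y y' : 𝔛 E M) : D x (y + y') = D x y + D x y'
  leibniz (f : C^∞⟮𝓘(ℝ, E), M; ℝ⟯) (x y : 𝔛 E M) (p : M) :
    D x (fmul f y) p = dir x f p • y p + f p • D x y p


section Existence

variable {E M : Type*} [NormedAddCommGroup E] [NormedSpace ℝ E] [FiniteDimensional ℝ E]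
  [TopologicalSpace M] [ChartedSpace E M] [IsManifold 𝓘(ℝ, E) ∞ M]


/-- The function `p ↦ g_p(X_p, Y_p)` for arbitrary (not necessarily smooth) vector fields. -/
noncomputable def Metric.appFun (g : Metric E M) (X Y : (p : M) → TangentSpace 𝓘(ℝ, E) p) : M → ℝ :=
  fun p => g.val p (X p) (Y p)

theorem Metric.contMDiffAt_appFun (g : Metric E M) {X Y : (p : M) → TangentSpace 𝓘(ℝ, E) p} {p : M}
    (hX : CMDiffAt ∞ (T% X) p) (hY : CMDiffAt ∞ (T% Y) p) :
    CMDiffAt ∞ (g.appFun X Y) p := by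
  have : ContMDiffAt 𝓘(ℝ, E) (𝓘(ℝ, E).prod 𝓘(ℝ)) ∞
      (fun m => Bundle.TotalSpace.mk' ℝ (E := Bundle.Trivial M ℝ) m (g.val m (X m) (Y m))) p := by
    apply ContMDiffAt.clm_bundle_apply₂ (F₁ := E) (F₂ := E)
    · exact g.contMDiff p
    · exact hX
    · exact hY
  simp only [Bundle.contMDiffAt_totalSpace] at this
  exact this.2

theorem Metric.mdiffAt_appFun (g : Metric E M) {X Y : (p : M) → TangentSpace 𝓘(ℝ, E) p} {p : M}
    (hX : MDiffAt (T% X) p) (hY : MDiffAt (T% Y) p) :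
    MDiffAt (g.appFun X Y) p := by
  have : MDifferentiableAt 𝓘(ℝ, E) (𝓘(ℝ, E).prod 𝓘(ℝ))
      (fun m => Bundle.TotalSpace.mk' ℝ (E := Bundle.Trivial M ℝ) m (g.val m (X m) (Y m))) p := by
    apply MDifferentiableAt.clm_bundle_apply₂ (F₁ := E) (F₂ := E)
    · exact (g.contMDiff p).mdifferentiableAt (by simp)
    · exact hX
    · exact hY
  simp only [mdifferentiableAt_totalSpace] at this
  exact this.2

/-- The Koszul expression for `2 g(∇_X Y, Z)`. -/
noncomputable def Metric.koszul (g : Metric E M)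
    (X Y Z : (p : M) → TangentSpace 𝓘(ℝ, E) p) (p : M) : ℝ :=
  mvfderiv 𝓘(ℝ, E) (g.appFun Y Z) p (X p) + mvfderiv 𝓘(ℝ, E) (g.appFun Z X) p (Y p)
    - mvfderiv 𝓘(ℝ, E) (g.appFun X Y) p (Z p)
    + g.val p (VectorField.mlieBracket 𝓘(ℝ, E) X Y p) (Z p)
    - g.val p (VectorField.mlieBracket 𝓘(ℝ, E) Y Z p) (X p)
    + g.val p (VectorField.mlieBracket 𝓘(ℝ, E) Z X p) (Y p)

theorem Metric.appFun_add_left (g : Metric E M) (X X' Y : (p : M) → TangentSpace 𝓘(ℝ, E) p) :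
    g.appFun (X + X') Y = g.appFun X Y + g.appFun X' Y := by
  ext p; simp [Metric.appFun]

theorem Metric.appFun_smul_left (g : Metric E M) (f : M → ℝ)
    (X Y : (p : M) → TangentSpace 𝓘(ℝ, E) p) :
    g.appFun (f • X) Y = f * g.appFun X Y := by
  ext p; simp [Metric.appFun]

theorem Metric.appFun_comm (g : Metric E M) (X Y : (p : M) → TangentSpace 𝓘(ℝ, E) p) :
    g.appFun X Y = g.appFun Y X := by
  ext p; exact g.symm p _ _

theorem Metric.koszul_tensorial (g : Metric E M) {X Y : (p : M) → TangentSpace 𝓘(ℝ, E) p} {p : M}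
    (hX : MDiffAt (T% X) p) (hY : MDiffAt (T% Y) p) :
    TensorialAt 𝓘(ℝ, E) E (fun Z => g.koszul X Y Z p) p where
  smul {f Z} hf hZ := by
    simp only [Metric.koszul, g.appFun_comm Y, g.appFun_smul_left]
    rw [mvfderiv_mul hf (g.mdiffAt_appFun hZ hY), mvfderiv_mul hf (g.mdiffAt_appFun hZ hX),
      VectorField.mlieBracket_smul_left hf hZ, VectorField.mlieBracket_smul_right hf hZ]
    simp [Metric.appFun]
    rw [g.symm p (Z p) (X p)]
    ring
  add {Z Z'} hZ hZ' := by
    simp only [Metric.koszul, g.appFun_comm Y, g.appFun_add_left]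
    rw [mvfderiv_add (g.mdiffAt_appFun hZ hY) (g.mdiffAt_appFun hZ' hY),
      mvfderiv_add (g.mdiffAt_appFun hZ hX) (g.mdiffAt_appFun hZ' hX),
      VectorField.mlieBracket_add_left hZ hZ', VectorField.mlieBracket_add_right hZ hZ']
    simp
    ring


theorem contMDiffAt_dir {f : M → ℝ} {X : (p : M) → TangentSpace 𝓘(ℝ, E) p} {p : M}
    (hf : CMDiffAt ∞ f p) (hX : CMDiffAt ∞ (T% X) p) :
    CMDiffAt ∞ (fun q => mvfderiv 𝓘(ℝ, E) f q (X q)) p := by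
  have h1 := hf.mfderiv_const (m := ∞) (by simp)
  have h2 := ContMDiffAt.clm_apply_of_inCoordinates h1 hX hf
  exact (contMDiff_snd_tangentBundle_modelSpace ℝ 𝓘(ℝ, ℝ)).contMDiffAt.comp p h2

theorem contMDiffAt_mlieBracket {X Y : (p : M) → TangentSpace 𝓘(ℝ, E) p} {p : M}
    (hX : CMDiffAt ∞ (T% X) p) (hY : CMDiffAt ∞ (T% Y) p) :
    CMDiffAt ∞ (T% (VectorField.mlieBracket 𝓘(ℝ, E) X Y)) p := by
  have : IsManifold 𝓘(ℝ, E) (minSmoothness ℝ 2) M := by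
    simpa using (inferInstance : IsManifold 𝓘(ℝ, E) 2 M)
  have : IsManifold 𝓘(ℝ, E) ((((⊤ : ℕ∞) : WithTop ℕ∞)) + 1) M := by
    simpa using (inferInstance : IsManifold 𝓘(ℝ, E) ∞ M)
  exact ContMDiffAt.mlieBracket_vectorField (n := ⊤) (m := ⊤) hX hY (by simp)

theorem Metric.contMDiffAt_koszul (g : Metric E M) {X Y Z : (p : M) → TangentSpace 𝓘(ℝ, E) p}
    {p : M} (hX : CMDiffAt ∞ (T% X) p) (hY : CMDiffAt ∞ (T% Y) p) (hZ : CMDiffAt ∞ (T% Z) p) :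
    CMDiffAt ∞ (g.koszul X Y Z) p :=
  ((((contMDiffAt_dir (g.contMDiffAt_appFun hY hZ) hX).add
    (contMDiffAt_dir (g.contMDiffAt_appFun hZ hX) hY)).sub
    (contMDiffAt_dir (g.contMDiffAt_appFun hX hY) hZ)).add
    (g.contMDiffAt_appFun (contMDiffAt_mlieBracket hX hY) hZ)).sub
    (g.contMDiffAt_appFun (contMDiffAt_mlieBracket hY hZ) hX) |>.add
    (g.contMDiffAt_appFun (contMDiffAt_mlieBracket hZ hX) hY)

theorem Metric.exists_dual (g : Metric E M) (p : M) (l : TangentSpace 𝓘(ℝ, E) p →L[ℝ] ℝ) :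
    ∃ v : TangentSpace 𝓘(ℝ, E) p, ∀ w, g.val p v w = l w := by
  have : FiniteDimensional ℝ (TangentSpace 𝓘(ℝ, E) p) := inferInstanceAs (FiniteDimensional ℝ E)
  let L : TangentSpace 𝓘(ℝ, E) p →ₗ[ℝ] Module.Dual ℝ (TangentSpace 𝓘(ℝ, E) p) :=
    { toFun := fun v => (g.val p v : TangentSpace 𝓘(ℝ, E) p →ₗ[ℝ] ℝ)
      map_add' := fun v w => by ext; simp
      map_smul' := fun c v => by ext; simp }
  have hinj : Function.Injective L := by
    rw [injective_iff_map_eq_zero]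
    intro v hv
    exact g.nondegenerate p v fun w => congrArg (fun φ => φ w) hv
  have hsurj : Function.Surjective L :=
    (LinearMap.injective_iff_surjective_of_finrank_eq_finrank
      (Subspace.dual_finrank_eq (K := ℝ) (V := TangentSpace 𝓘(ℝ, E) p)).symm).1 hinj
  obtain ⟨v, hv⟩ := hsurj (l : TangentSpace 𝓘(ℝ, E) p →ₗ[ℝ] ℝ)
  exact ⟨v, fun w => congrArg (fun φ => φ w) hv⟩

/-- A vector field whose products with all locally defined smooth fields are smooth is smooth. -/
theorem Metric.contMDiffAt_of_app (g : Metric E M) {V : (p : M) → TangentSpace 𝓘(ℝ, E) p} {p : M}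
    (h : ∀ Z : (p : M) → TangentSpace 𝓘(ℝ, E) p, CMDiffAt ∞ (T% Z) p →
      CMDiffAt ∞ (g.appFun V Z) p) : CMDiffAt ∞ (T% V) p := by
  let e := trivializationAt E (TangentSpace 𝓘(ℝ, E) : M → Type _) p
  have hp : p ∈ e.baseSet := FiberBundle.mem_baseSet_trivializationAt' p
  let ι := Fin (Module.finrank ℝ E)
  let b : Module.Basis ι ℝ E := Module.finBasis ℝ E
  let s : ι → (p : M) → TangentSpace 𝓘(ℝ, E) p := e.localFrame b
  have hs (i : ι) : CMDiffAt ∞ (T% (s i)) p := contMDiffAt_localFrame_of_mem ∞ e b i hp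
  let G : M → (ι → ℝ) →L[ℝ] (ι → ℝ) := fun m => ∑ i, ∑ j, g.appFun (s i) (s j) m •
    (ContinuousLinearMap.proj (R := ℝ) (φ := fun _ : ι => ℝ) i).smulRight
      (Pi.single j (1 : ℝ) : ι → ℝ)
  have hG : CMDiffAt ∞ G p := by
    refine contMDiffAt_finsetSum fun i _ => contMDiffAt_finsetSum fun j _ => ?_
    exact (g.contMDiffAt_appFun (hs i) (hs j)).smul contMDiffAt_const
  have hGa (m : M) (a : ι → ℝ) (j : ι) : G m a j = g.val m (∑ i, a i • s i m) (s j m) := by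
    simp [G, Metric.appFun, Pi.single_apply, mul_comm]
  let c : M → ι → ℝ := fun m j => g.appFun V (s j) m
  have hc : ContMDiffAt 𝓘(ℝ, E) 𝓘(ℝ, ι → ℝ) ∞ c p := contMDiffAt_pi_space.2 fun j => h _ (hs j)
  have hinj (m : M) (hm : m ∈ e.baseSet) : (G m).IsInvertible := by
    have hker : LinearMap.ker (G m : (ι → ℝ) →ₗ[ℝ] (ι → ℝ)) = ⊥ := by
      rw [LinearMap.ker_eq_bot']
      intro a ha
      have h0 : ∑ i, a i • s i m = 0 := by
        refine g.nondegenerate m _ fun w => ?_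
        have hw := (e.basisAt b hm).sum_repr w
        rw [← hw, map_sum]
        refine Finset.sum_eq_zero fun j _ => ?_
        have := congrFun ha j
        rw [map_smul]
        have h2 : s j m = e.basisAt b hm j := e.localFrame_apply_of_mem_baseSet b hm
        rw [← h2]
        have h3 := hGa m a j
        simp only [ContinuousLinearMap.coe_coe] at this
        rw [← h3, this]; simp
      have h1 := (e.basisAt b hm).linearIndependent
      rw [Fintype.linearIndependent_iff] at h1
      ext i
      refine h1 a ?_ i
      rw [← h0]
      refine Finset.sum_congr rfl fun i _ => ?_
      rw [show s i m = e.basisAt b hm i from e.localFrame_apply_of_mem_baseSet b hm]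
    exact ⟨ContinuousLinearEquiv.ofBijective (G m) hker
      (LinearMap.range_eq_top.2 ((LinearMap.injective_iff_surjective).1 (LinearMap.ker_eq_bot.1 hker))),
      by ext; simp⟩
  have hinv : ContMDiffAt 𝓘(ℝ, E) 𝓘(ℝ, ι → ℝ) ∞ (fun m => (G m).inverse (c m)) p := by
    have h1 : CMDiffAt ∞ (fun m => (G m).inverse) p :=
      (ContinuousLinearMap.IsInvertible.contDiffAt_map_inverse (hinj p hp)).contMDiffAt.comp p hG
    exact h1.clm_apply hc
  have hV : ∀ m ∈ e.baseSet, V m = ∑ i, (G m).inverse (c m) i • s i m := by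
    intro m hm
    have h1 : G m ((G m).inverse (c m)) = c m := by
      obtain ⟨A, hA⟩ := hinj m hm
      rw [← hA]; simp
    rw [← sub_eq_zero]
    refine g.nondegenerate m _ fun w => ?_
    rw [← (e.basisAt b hm).sum_repr w, map_sum]
    refine Finset.sum_eq_zero fun j _ => ?_
    rw [map_smul, ← show s j m = e.basisAt b hm j from e.localFrame_apply_of_mem_baseSet b hm,
      map_sub, sub_apply, ← hGa, h1]
    simp [c, Metric.appFun]
  have hsum : CMDiffAt ∞ (T% (fun m => ∑ i, (G m).inverse (c m) i • s i m)) p := by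
    refine ContMDiffAt.sum_section fun i _ => ?_
    exact ContMDiffAt.smul_section (contMDiffAt_pi_space.1 hinv i) (hs i)
  refine hsum.congr_of_eventuallyEq ?_
  filter_upwards [e.open_baseSet.mem_nhds hp] with m hm
  rw [hV m hm]

theorem Metric.exists_koszul (g : Metric E M) (X Y : 𝔛 E M) :
    ∃ V : 𝔛 E M, ∀ (p : M) (Z : (p : M) → TangentSpace 𝓘(ℝ, E) p), MDiffAt (T% Z) p →
      g.val p (V p) (Z p) = 2⁻¹ * g.koszul X Y Z p := by
  have h (p : M) := g.exists_dual p ((2⁻¹ : ℝ) • TensorialAt.mkHom _ p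
    (g.koszul_tensorial (X.mdifferentiableAt (x := p)) (Y.mdifferentiableAt (x := p))))
  choose V hV using h
  have hV' : ∀ (p : M) (Z : (p : M) → TangentSpace 𝓘(ℝ, E) p), MDiffAt (T% Z) p →
      g.val p (V p) (Z p) = 2⁻¹ * g.koszul X Y Z p := by
    intro p Z hZ
    rw [hV p (Z p)]
    simp only [smul_apply, smul_eq_mul]
    rw [TensorialAt.mkHom_apply _ hZ]
  refine ⟨⟨V, fun p => g.contMDiffAt_of_app fun Z hZ => ?_⟩, hV'⟩
  have h1 : CMDiffAt ∞ (fun q => (2⁻¹ : ℝ) * g.koszul X Y Z q) p :=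
    contMDiffAt_const.mul (g.contMDiffAt_koszul (X.contMDiff p) (Y.contMDiff p) hZ)
  refine h1.congr_of_eventuallyEq ?_
  have h2 : ∀ᶠ q in nhds p, CMDiffAt 1 (T% Z) q :=
    (contMDiffAt_iff_contMDiffAt_nhds (by simp)).1 (hZ.of_le (by simp))
  filter_upwards [h2] with q hq
  exact hV' q Z (hq.mdifferentiableAt (by simp))

theorem Metric.ext_of_extend (g : Metric E M) {p : M} {u v : TangentSpace 𝓘(ℝ, E) p}
    (h : ∀ Z : (p : M) → TangentSpace 𝓘(ℝ, E) p, MDiffAt (T% Z) p →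
      g.val p u (Z p) = g.val p v (Z p)) : u = v := by
  rw [← sub_eq_zero]
  refine g.nondegenerate p _ fun w => ?_
  have := h (FiberBundle.extend E w) (FiberBundle.mdifferentiableAt_extend _ _ _)
  simp only [FiberBundle.extend_apply_self] at this
  simp [this]

/-- The torsion `T(x, y) = D_x y - D_y x - [x, y]`. -/
noncomputable def LinearConnection.torsion (D : LinearConnection E M) (x y : 𝔛 E M) : 𝔛 E M :=
  D.D x y - D.D y x - lie x y

/-- `D g`, i.e. `(D_x g)(y, z) = x g(y, z) - g(D_x y, z) - g(y, D_x z)`. -/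
noncomputable def LinearConnection.covMetric (D : LinearConnection E M) (g : Metric E M)
    (x y z : 𝔛 E M) : M → ℝ :=
  dir x (g.app y z) - g.app (D.D x y) z - g.app y (D.D x z)

/-- `D` is a Levi-Civita connection of `g`: it is torsion-free and `D g = 0`. -/
structure IsLeviCivita (g : Metric E M) (D : LinearConnection E M) : Prop where
  torsion_eq_zero (x y : 𝔛 E M) : D.torsion x y = 0
  covMetric_eq_zero (x y z : 𝔛 E M) : D.covMetric g x y z = 0

theorem exists_isLeviCivita (g : Metric E M) : ∃ D : LinearConnection E M, IsLeviCivita g D := by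
  choose D hD using g.exists_koszul
  have hx (x : 𝔛 E M) (p : M) : MDiffAt (T% (x : (p : M) → TangentSpace 𝓘(ℝ, E) p)) p :=
    x.mdifferentiableAt
  have hf (f : C^∞⟮𝓘(ℝ, E), M; ℝ⟯) (p : M) : MDiffAt (f : M → ℝ) p := f.mdifferentiableAt
  have hco (f : C^∞⟮𝓘(ℝ, E), M; ℝ⟯) (x : 𝔛 E M) :
      (fmul f x : (p : M) → TangentSpace 𝓘(ℝ, E) p) = (f : M → ℝ) • ⇑x := rfl
  refine ⟨⟨D, ?_, ?_, ?_, ?_⟩, ⟨?_, ?_⟩⟩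
  · intro x x' y
    ext1 p
    refine g.ext_of_extend fun Z hZ => ?_
    rw [hD (x + x') y p Z hZ, ContMDiffSection.coe_add (D x y), Pi.add_apply, map_add, add_apply,
      hD x y p Z hZ, hD x' y p Z hZ]
    simp only [Metric.koszul, ContMDiffSection.coe_add, g.appFun_comm Z, g.appFun_add_left]
    rw [mvfderiv_add (g.mdiffAt_appFun (hx x p) hZ) (g.mdiffAt_appFun (hx x' p) hZ),
      mvfderiv_add (g.mdiffAt_appFun (hx x p) (hx y p)) (g.mdiffAt_appFun (hx x' p) (hx y p)),
      VectorField.mlieBracket_add_left (hx x p) (hx x' p),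
      VectorField.mlieBracket_add_right (hx x p) (hx x' p)]
    simp only [Pi.add_apply, map_add, add_apply]
    ring
  · intro f x y
    ext1 p
    refine g.ext_of_extend fun Z hZ => ?_
    rw [hD (fmul f x) y p Z hZ, hco f (D x y), Pi.smul_apply', map_smul, smul_apply,
      hD x y p Z hZ]
    simp only [Metric.koszul, hco, g.appFun_comm Z, g.appFun_smul_left]
    rw [mvfderiv_mul (hf f p) (g.mdiffAt_appFun (hx x p) hZ),
      mvfderiv_mul (hf f p) (g.mdiffAt_appFun (hx x p) (hx y p)),
      VectorField.mlieBracket_smul_left (hf f p) (hx x p),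
      VectorField.mlieBracket_smul_right (hf f p) (hx x p)]
    simp [Metric.appFun]
    rw [g.symm p (x p) (y p), g.symm p (x p) (Z p)]
    ring
  · intro x y y'
    ext1 p
    refine g.ext_of_extend fun Z hZ => ?_
    rw [hD x (y + y') p Z hZ, ContMDiffSection.coe_add (D x y), Pi.add_apply, map_add, add_apply,
      hD x y p Z hZ, hD x y' p Z hZ]
    simp only [Metric.koszul, ContMDiffSection.coe_add, g.appFun_comm x, g.appFun_add_left]
    rw [mvfderiv_add (g.mdiffAt_appFun (hx y p) hZ) (g.mdiffAt_appFun (hx y' p) hZ),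
      mvfderiv_add (g.mdiffAt_appFun (hx y p) (hx x p)) (g.mdiffAt_appFun (hx y' p) (hx x p)),
      VectorField.mlieBracket_add_left (hx y p) (hx y' p),
      VectorField.mlieBracket_add_right (hx y p) (hx y' p)]
    simp only [Pi.add_apply, map_add, add_apply]
    ring
  · intro f x y p
    refine g.ext_of_extend fun Z hZ => ?_
    rw [hD x (fmul f y) p Z hZ, map_add, add_apply, map_smul, map_smul, smul_apply, smul_apply,
      hD x y p Z hZ]
    simp only [Metric.koszul, hco, g.appFun_comm x, g.appFun_smul_left]
    rw [mvfderiv_mul (hf f p) (g.mdiffAt_appFun (hx y p) hZ),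
      mvfderiv_mul (hf f p) (g.mdiffAt_appFun (hx y p) (hx x p)),
      VectorField.mlieBracket_smul_left (hf f p) (hx y p),
      VectorField.mlieBracket_smul_right (hf f p) (hx y p)]
    simp [Metric.appFun, dir]
    ring
  · intro x y
    ext1 p
    refine g.ext_of_extend fun Z hZ => ?_
    change g.val p (D x y p - D y x p - VectorField.mlieBracket 𝓘(ℝ, E) x y p) (Z p)
      = g.val p 0 (Z p)
    rw [map_sub, map_sub, sub_apply, sub_apply, hD x y p Z hZ, hD y x p Z hZ]
    simp only [Metric.koszul, g.appFun_comm Z, g.appFun_comm (⇑y) (⇑x)]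
    rw [VectorField.mlieBracket_swap_apply (V := y) (W := x),
      VectorField.mlieBracket_swap_apply (V := Z) (W := y),
      VectorField.mlieBracket_swap_apply (V := Z) (W := x)]
    simp
    ring
  · intro x y z
    funext p
    change mvfderiv 𝓘(ℝ, E) (g.appFun y z) p (x p) - g.val p (D x y p) (z p)
        - g.val p (y p) (D x z p) = 0
    rw [g.symm p (y p), hD x y p z (hx z p), hD x z p y (hx y p)]
    simp only [Metric.koszul, g.appFun_comm z, g.appFun_comm (⇑y) (⇑x)]
    rw [VectorField.mlieBracket_swap_apply (V := z) (W := y),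
      VectorField.mlieBracket_swap_apply (V := z) (W := x),
      VectorField.mlieBracket_swap_apply (V := y) (W := x)]
    simp
    ring

end Existence

section Structures

variable {E M : Type*} [NormedAddCommGroup E] [NormedSpace ℝ E] [FiniteDimensional ℝ E]
  [TopologicalSpace M] [ChartedSpace E M] [IsManifold 𝓘(ℝ, E) ∞ M]

/-- The Levi-Civita connection `∇` of `g`. -/
noncomputable def leviCivita (g : Metric E M) : LinearConnection E M :=
  (exists_isLeviCivita g).choose

theorem isLeviCivita_leviCivita (g : Metric E M) : IsLeviCivita g (leviCivita g) :=
  (exists_isLeviCivita g).choose_spec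

/-- `(D_x φ) y = D_x (φ y) - φ (D_x y)`. -/
noncomputable def LinearConnection.covEnd (D : LinearConnection E M) (φ : EndField E M)
    (x y : 𝔛 E M) : 𝔛 E M :=
  D.D x (φ.app y) - φ.app (D.D x y)

/-- `(D_x η)(y) = x (η(y)) - η(D_x y)`. -/
noncomputable def LinearConnection.covOneForm (D : LinearConnection E M) (η : OneForm E M)
    (x y : 𝔛 E M) : M → ℝ :=
  dir x (η.app y) - η.app (D.D x y)

/-- The Lie derivative `(𝔏_ξ g)(x, y) = ξ g(x, y) - g([ξ, x], y) - g(x, [ξ, y])`. -/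
noncomputable def Metric.lieDeriv (g : Metric E M) (ξ x y : 𝔛 E M) : M → ℝ :=
  dir ξ (g.app x y) - g.app (lie ξ x) y - g.app x (lie ξ y)

/-- `ξ` is a Killing vector field of `g`. -/
def Metric.IsKilling (g : Metric E M) (ξ : 𝔛 E M) : Prop :=
  ∀ x y : 𝔛 E M, g.lieDeriv ξ x y = 0

/-- Total skew-symmetry of a `(0,3)`-tensor field (given by its values on vector fields), i.e. the
tensor field is a 3-form. The remaining transposition follows from these two. -/
structure IsTotallySkew (τ : 𝔛 E M → 𝔛 E M → 𝔛 E M → M → ℝ) : Prop where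
  skew_left (x y z : 𝔛 E M) : τ x y z = -τ y x z
  skew_right (x y z : 𝔛 E M) : τ x y z = -τ x z y

/-- The torsion as a `(0,3)`-tensor, `T(x, y, z) = g(T(x, y), z)`. -/
noncomputable def LinearConnection.torsion₃ (D : LinearConnection E M) (g : Metric E M)
    (x y z : 𝔛 E M) : M → ℝ :=
  g.app (D.torsion x y) z

end Structures

/-- A pseudo-Riemannian manifold with an almost contact metric structure `(φ, ξ, η, g)`. The
compatibility is `g(φx, φy) = g(x, y) + η(x) η(y)`, so that `η = -g(ξ, ·)` and `g(ξ, ξ) = -1`. -/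
structure AlmostContactMetric (E M : Type*) [NormedAddCommGroup E] [NormedSpace ℝ E]
    [TopologicalSpace M] [ChartedSpace E M] [IsManifold 𝓘(ℝ, E) ∞ M] where
  /-- the endomorphism field -/
  φ : EndField E M
  /-- the Reeb vector field -/
  ξ : 𝔛 E M
  /-- the contact form -/
  η : OneForm E M
  /-- the metric -/
  g : Metric E M
  φ_sq (p : M) (u : TangentSpace 𝓘(ℝ, E) p) : φ p (φ p u) = -u + η p u • ξ p
  φ_ξ (p : M) : φ p (ξ p) = 0
  η_φ (p : M) (u : TangentSpace 𝓘(ℝ, E) p) : η p (φ p u) = 0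
  η_ξ (p : M) : η p (ξ p) = 1
  compat (p : M) (u v : TangentSpace 𝓘(ℝ, E) p) :
    g.val p (φ p u) (φ p v) = g.val p u v + η p u * η p v

namespace AlmostContactMetric

variable {E M : Type*} [NormedAddCommGroup E] [NormedSpace ℝ E] [FiniteDimensional ℝ E]
  [TopologicalSpace M] [ChartedSpace E M] [IsManifold 𝓘(ℝ, E) ∞ M]

/-- The fundamental tensor `F(x, y, z) = g((∇_x φ) y, z)`. -/
noncomputable def F (S : AlmostContactMetric E M) (x y z : 𝔛 E M) : M → ℝ :=
  S.g.app ((leviCivita S.g).covEnd S.φ x y) z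

/-- `dη(x, y) = (∇_x η) y - (∇_y η) x`. -/
noncomputable def dη (S : AlmostContactMetric E M) (x y : 𝔛 E M) : M → ℝ :=
  (leviCivita S.g).covOneForm S.η x y - (leviCivita S.g).covOneForm S.η y x

/-- `[φ, φ](x, y) = φ² [x, y] + [φ x, φ y] - φ [φ x, y] - φ [x, φ y]`. -/
noncomputable def bracketφ (S : AlmostContactMetric E M) (x y : 𝔛 E M) : 𝔛 E M :=
  S.φ.app (S.φ.app (lie x y)) + lie (S.φ.app x) (S.φ.app y)
    - S.φ.app (lie (S.φ.app x) y) - S.φ.app (lie x (S.φ.app y))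

/-- The Nijenhuis tensor `N = [φ, φ] + ξ ⊗ dη`. -/
noncomputable def N (S : AlmostContactMetric E M) (x y : 𝔛 E M) (p : M) :
    TangentSpace 𝓘(ℝ, E) p :=
  S.bracketφ x y p + S.dη x y p • S.ξ p

/-- `N(x, y, z) = g(N(x, y), z)`. -/
noncomputable def N₃ (S : AlmostContactMetric E M) (x y z : 𝔛 E M) : M → ℝ :=
  fun p => S.g.val p (S.N x y p) (z p)

/-- The symmetric braces `{x, y} = ∇_x y + ∇_y x`. -/
noncomputable def braces (S : AlmostContactMetric E M) (x y : 𝔛 E M) : 𝔛 E M :=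
  (leviCivita S.g).D x y + (leviCivita S.g).D y x

/-- `{φ, φ}(x, y) = {φ x, φ y} + φ² {x, y} - φ {φ x, y} - φ {x, φ y}`. -/
noncomputable def bracesφ (S : AlmostContactMetric E M) (x y : 𝔛 E M) : 𝔛 E M :=
  S.braces (S.φ.app x) (S.φ.app y) + S.φ.app (S.φ.app (S.braces x y))
    - S.φ.app (S.braces (S.φ.app x) y) - S.φ.app (S.braces x (S.φ.app y))

/-- The associated Nijenhuis tensor `N̂ = {φ, φ} - ξ ⊗ 𝔏_ξ g`. -/
noncomputable def Nhat (S : AlmostContactMetric E M) (x y : 𝔛 E M) (p : M) :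
    TangentSpace 𝓘(ℝ, E) p :=
  S.bracesφ x y p - S.g.lieDeriv S.ξ x y p • S.ξ p

/-- `D` is a natural connection: `D φ = D ξ = D η = D g = 0`. -/
structure IsNatural (S : AlmostContactMetric E M) (D : LinearConnection E M) : Prop where
  φ_parallel (x y : 𝔛 E M) : D.covEnd S.φ x y = 0
  ξ_parallel (x : 𝔛 E M) : D.D x S.ξ = 0
  η_parallel (x y : 𝔛 E M) : D.covOneForm S.η x y = 0
  g_parallel (x y z : 𝔛 E M) : D.covMetric S.g x y z = 0

end AlmostContactMetric

end PseudoRiemannian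

/-!
Write `F` and `∇η` for the Levi-Civita derivatives of the structure. For a connection `D` with
contorsion `K(x, y, z) = g(D_x y - ∇_x y, z)`, being natural means that `K` is skew in `y, z` and
`K(x, y, z) - K(x, φy, φz) = ψ(x, y, z) := F(x, y, φz) - (∇_x η)(y) η(z)`. Everything is governed by
`P(x, y, z) = F(φx, y, z) + ψ(x, y, z)`, which is skew in `y, z`: its alternation in `x, y` is the
Nijenhuis tensor `N` and, when `ξ` is Killing, its symmetrization is `{φ, φ}`. A tensor skew in its
last two arguments is a 3-form iff its alternation is one, and iff its symmetrization vanishes.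

If `D` is natural with totally skew torsion, then `K` is a 3-form and
`P = K - (K(φ·, φ·, ·) + K(φ·, ·, φ·) + K(·, φ·, φ·))`, so `P` is a 3-form and the cyclic sum of `ψ`
is `2K + P`; hence `D` is unique. Conversely, if `P` is a 3-form and `ξ` is Killing, the `K` defined
by the last formula is the contorsion of such a connection.
-/

namespace PseudoRiemannian

section Extension

variable {E H M F : Type*} [NormedAddCommGroup E] [NormedSpace ℝ E] [FiniteDimensional ℝ E]
  [TopologicalSpace H] {I : ModelWithCorners ℝ E H} [TopologicalSpace M] [ChartedSpace H M]
  [IsManifold I ∞ M] [T2Space M] [NormedAddCommGroup F] [NormedSpace ℝ F]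
  {V : M → Type*} [TopologicalSpace (Bundle.TotalSpace F V)] [∀ p, AddCommGroup (V p)]
  [∀ p, TopologicalSpace (V p)] [∀ p, Module ℝ (V p)] [FiberBundle F V] [VectorBundle ℝ F V]
  [ContMDiffVectorBundle ∞ F V I]

theorem exists_contMDiffSection_apply_eq {p : M} (v : V p) : ∃ s : Cₛ^∞⟮I; F, V⟯, s p = v := by
  obtain ⟨U, hU, hs⟩ := FiberBundle.exists_contMDiffOn_extend (k := ∞) I F v
  obtain ⟨f, hf, -⟩ := (SmoothBumpFunction.nhds_basis_support (I := I)
    (interior_mem_nhds.2 hU)).mem_iff.1 (interior_mem_nhds.2 hU)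
  refine ⟨⟨(f : M → ℝ) • FiberBundle.extend F v, ?_⟩, ?_⟩
  · exact ContMDiffOn.smul_section_of_tsupport f.contMDiff.contMDiffOn isOpen_interior hf
      (hs.mono interior_subset)
  · change f p • FiberBundle.extend F v p = v
    rw [f.eq_one, FiberBundle.extend_apply_self, one_smul]

end Extension

section Tensors

variable {E M : Type*} [NormedAddCommGroup E] [NormedSpace ℝ E] [TopologicalSpace M]
  [ChartedSpace E M] [IsManifold 𝓘(ℝ, E) ∞ M] {τ : 𝔛 E M → 𝔛 E M → 𝔛 E M → M → ℝ}

theorem IsTotallySkew.cyclic (hτ : IsTotallySkew τ) (x y z : 𝔛 E M) : τ x y z = τ y z x := by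
  rw [hτ.skew_left, hτ.skew_right, neg_neg]

theorem isTotallySkew_alternation_iff (hτ : ∀ x y z, τ x y z = -τ x z y) :
    IsTotallySkew (fun x y z => τ x y z - τ y x z) ↔ IsTotallySkew τ := by
  refine ⟨fun h => ⟨fun x y z => ?_, hτ⟩, fun h => ⟨fun x y z => ?_, fun x y z => ?_⟩⟩
  · funext p
    have two_mul_eq (x y z : 𝔛 E M) : 2 * τ x y z p = τ x y z p - τ y x z p := by
      have h₁ := congrFun (h.cyclic x y z) p
      have h₂ := congrFun (h.cyclic z x y) p
      have h₃ := congrFun (hτ x y z) p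
      have h₄ := congrFun (hτ y z x) p
      have h₅ := congrFun (hτ z x y) p
      simp only [Pi.sub_apply, Pi.neg_apply] at h₁ h₂ h₃ h₄ h₅
      linarith
    linarith [two_mul_eq x y z, two_mul_eq y x z, Pi.neg_apply (τ y x z) p]
  · ring
  · linear_combination 2 * h.skew_right x y z - h.skew_left y x z - h.skew_left z x y

theorem isTotallySkew_cyclicSum (hτ : ∀ x y z, τ x y z = -τ x z y) :
    IsTotallySkew (fun x y z => τ x y z + τ y z x + τ z x y) where
  skew_left x y z := by linear_combination hτ x y z + hτ y z x + hτ z x y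
  skew_right x y z := by linear_combination hτ x y z + hτ y z x + hτ z x y

theorem IsTotallySkew.sub {σ : 𝔛 E M → 𝔛 E M → 𝔛 E M → M → ℝ} (hσ : IsTotallySkew σ)
    (hτ : IsTotallySkew τ) : IsTotallySkew (fun x y z => σ x y z - τ x y z) where
  skew_left x y z := by linear_combination hσ.skew_left x y z - hτ.skew_left x y z
  skew_right x y z := by linear_combination hσ.skew_right x y z - hτ.skew_right x y z

theorem IsTotallySkew.smul (c : ℝ) (hτ : IsTotallySkew τ) :
    IsTotallySkew (fun x y z => c • τ x y z) where
  skew_left x y z := by rw [hτ.skew_left, smul_neg]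
  skew_right x y z := by rw [hτ.skew_right, smul_neg]

end Tensors

section Fields

variable {E M : Type*} [NormedAddCommGroup E] [NormedSpace ℝ E] [TopologicalSpace M]
  [ChartedSpace E M] [IsManifold 𝓘(ℝ, E) ∞ M]

theorem Metric.app_comm (g : Metric E M) (x y : 𝔛 E M) : g.app x y = g.app y x :=
  funext fun p => g.symm p (x p) (y p)

@[simp]
theorem Metric.app_add_left (g : Metric E M) (x x' y : 𝔛 E M) :
    g.app (x + x') y = g.app x y + g.app x' y :=
  funext fun p => by simp [app]

@[simp]
theorem Metric.app_sub_left (g : Metric E M) (x x' y : 𝔛 E M) :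
    g.app (x - x') y = g.app x y - g.app x' y :=
  funext fun p => by simp [app]

@[simp]
theorem Metric.app_neg_left (g : Metric E M) (x y : 𝔛 E M) : g.app (-x) y = -g.app x y :=
  funext fun p => by simp [app]

@[simp]
theorem Metric.app_zero_left (g : Metric E M) (y : 𝔛 E M) : g.app 0 y = 0 :=
  funext fun p => by simp [app]

@[simp]
theorem Metric.app_smul_left (g : Metric E M) (c : ℝ) (x y : 𝔛 E M) :
    g.app (c • x) y = c • g.app x y :=
  funext fun p => by simp [app]

@[simp]
theorem Metric.app_fmul_left (g : Metric E M) (f : C^∞⟮𝓘(ℝ, E), M; ℝ⟯) (x y : 𝔛 E M) :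
    g.app (fmul f x) y = f * g.app x y :=
  funext fun p => by simp [app, fmul]

end Fields

section Connections

variable {E M : Type*} [NormedAddCommGroup E] [NormedSpace ℝ E] [TopologicalSpace M]
  [ChartedSpace E M] [IsManifold 𝓘(ℝ, E) ∞ M]

namespace LinearConnection

variable (D : LinearConnection E M)

theorem neg_left (x y : 𝔛 E M) : D.D (-x) y = -D.D x y :=
  map_neg (AddMonoidHom.mk' (fun x => D.D x y) fun x x' => D.add_left x x' y) x

theorem zero_left (y : 𝔛 E M) : D.D 0 y = 0 :=
  map_zero (AddMonoidHom.mk' (fun x => D.D x y) fun x x' => D.add_left x x' y)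

theorem neg_right (x y : 𝔛 E M) : D.D x (-y) = -D.D x y :=
  map_neg (AddMonoidHom.mk' (D.D x) (D.add_right x)) y

theorem zero_right (x : 𝔛 E M) : D.D x 0 = 0 :=
  map_zero (AddMonoidHom.mk' (D.D x) (D.add_right x))

theorem app_leibniz (g : Metric E M) (f : C^∞⟮𝓘(ℝ, E), M; ℝ⟯) (x y z : 𝔛 E M) :
    g.app (D.D x (fmul f y)) z = dir x f * g.app y z + f * g.app (D.D x y) z :=
  funext fun p => by simp [Metric.app, D.leibniz]

end LinearConnection

end Connections

section LeviCivita

variable {E M : Type*} [NormedAddCommGroup E] [NormedSpace ℝ E] [FiniteDimensional ℝ E]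
  [TopologicalSpace M] [ChartedSpace E M] [IsManifold 𝓘(ℝ, E) ∞ M] (g : Metric E M)

theorem Metric.eq_of_app_eq [T2Space M] {x y : 𝔛 E M} (h : ∀ z : 𝔛 E M, g.app x z = g.app y z) :
    x = y := by
  ext1 p
  refine sub_eq_zero.1 (g.nondegenerate p _ fun v => ?_)
  obtain ⟨z, rfl⟩ := exists_contMDiffSection_apply_eq (I := 𝓘(ℝ, E)) (F := E) v
  rw [map_sub, sub_apply, sub_eq_zero]
  exact congrFun (h z) p

theorem Metric.eq_zero_of_app_eq_zero [T2Space M] {x : 𝔛 E M} (h : ∀ z : 𝔛 E M, g.app x z = 0) :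
    x = 0 :=
  g.eq_of_app_eq fun z => by rw [h z, g.app_zero_left]

/-- The function `g(x, y)` as a smooth function, a possible coefficient in `fmul`. -/
noncomputable def Metric.smoothApp (x y : 𝔛 E M) : C^∞⟮𝓘(ℝ, E), M; ℝ⟯ :=
  ⟨g.app x y, fun p => g.contMDiffAt_appFun (x.contMDiff p) (y.contMDiff p)⟩

@[simp]
theorem Metric.coe_smoothApp (x y : 𝔛 E M) : ⇑(g.smoothApp x y) = g.app x y := rfl

theorem Metric.exists_dual_of_tensorialAt {Φ : ((p : M) → TangentSpace 𝓘(ℝ, E) p) → M → ℝ}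
    (hΦ : ∀ p, TensorialAt 𝓘(ℝ, E) E (fun Z => Φ Z p) p)
    (hΦ_smooth : ∀ {Z p}, CMDiffAt ∞ (T% Z) p → CMDiffAt ∞ (Φ Z) p) :
    ∃ v : 𝔛 E M, ∀ z : 𝔛 E M, g.app v z = Φ z := by
  choose V hV using fun p => g.exists_dual p (TensorialAt.mkHom _ p (hΦ p))
  have app_eq {Z p} (hZ : MDiffAt (T% Z) p) : g.val p (V p) (Z p) = Φ Z p := by
    rw [hV, TensorialAt.mkHom_apply _ hZ]
  refine ⟨⟨V, fun p => g.contMDiffAt_of_app fun Z hZ => ?_⟩,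
    fun z => funext fun p => app_eq z.mdifferentiableAt⟩
  have hZ_near : ∀ᶠ q in nhds p, CMDiffAt 1 (T% Z) q :=
    (contMDiffAt_iff_contMDiffAt_nhds (by simp)).1 (hZ.of_le (by simp))
  refine (hΦ_smooth hZ).congr_of_eventuallyEq ?_
  filter_upwards [hZ_near] with q hq using app_eq (hq.mdifferentiableAt (by simp))

theorem Metric.koszul_tensorial_left {Y Z : (p : M) → TangentSpace 𝓘(ℝ, E) p} {p : M}
    (hY : MDiffAt (T% Y) p) (hZ : MDiffAt (T% Z) p) :
    TensorialAt 𝓘(ℝ, E) E (fun X => g.koszul X Y Z p) p where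
  smul {f X} hf hX := by
    simp only [koszul, g.appFun_comm Z, g.appFun_smul_left]
    rw [mvfderiv_mul hf (g.mdiffAt_appFun hX hZ), mvfderiv_mul hf (g.mdiffAt_appFun hX hY),
      VectorField.mlieBracket_smul_left hf hX, VectorField.mlieBracket_smul_right hf hX]
    simp only [appFun, Pi.smul_apply', map_add, map_smul, add_apply, smul_apply, smul_eq_mul,
      neg_smul, map_neg, neg_apply]
    rw [g.symm p (X p) (Y p), g.symm p (X p) (Z p)]
    ring
  add {X X'} hX hX' := by
    simp only [koszul, g.appFun_comm Z, g.appFun_add_left]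
    rw [mvfderiv_add (g.mdiffAt_appFun hX hZ) (g.mdiffAt_appFun hX' hZ),
      mvfderiv_add (g.mdiffAt_appFun hX hY) (g.mdiffAt_appFun hX' hY),
      VectorField.mlieBracket_add_left hX hX', VectorField.mlieBracket_add_right hX hX']
    simp only [Pi.add_apply, map_add, add_apply]
    ring

theorem dir_app_eq_leviCivita (x y z : 𝔛 E M) :
    dir x (g.app y z) = g.app ((leviCivita g).D x y) z + g.app y ((leviCivita g).D x z) := by
  have h := (isLeviCivita_leviCivita g).covMetric_eq_zero x y z
  rw [LinearConnection.covMetric] at h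
  linear_combination h

theorem lie_eq_leviCivita (x y : 𝔛 E M) :
    lie x y = (leviCivita g).D x y - (leviCivita g).D y x :=
  (sub_eq_zero.1 ((isLeviCivita_leviCivita g).torsion_eq_zero x y)).symm

theorem koszul_eq_leviCivita (x y z : 𝔛 E M) :
    g.koszul x y z = 2 * g.app ((leviCivita g).D x y) z := by
  have koszul_eq : g.koszul x y z = dir x (g.app y z) + dir y (g.app z x) - dir z (g.app x y)
      + g.app (lie x y) z - g.app (lie y z) x + g.app (lie z x) y := rfl
  rw [koszul_eq]
  simp only [dir_app_eq_leviCivita, lie_eq_leviCivita g, g.app_sub_left]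
  rw [g.app_comm y, g.app_comm z, g.app_comm x]
  ring

theorem exists_dual_leviCivita_left (y z : 𝔛 E M) :
    ∃ v : 𝔛 E M, ∀ x : 𝔛 E M, g.app v x = g.app ((leviCivita g).D x y) z := by
  obtain ⟨v, hv⟩ := g.exists_dual_of_tensorialAt (Φ := fun X => g.koszul X y z)
    (fun _ => g.koszul_tensorial_left y.mdifferentiableAt z.mdifferentiableAt)
    (fun hX => g.contMDiffAt_koszul hX (y.contMDiff _) (z.contMDiff _))
  refine ⟨(2⁻¹ : ℝ) • v, fun x => ?_⟩
  rw [g.app_smul_left, hv, koszul_eq_leviCivita]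
  funext p
  simp

theorem lieDeriv_eq_leviCivita (ξ x y : 𝔛 E M) :
    g.lieDeriv ξ x y = g.app ((leviCivita g).D x ξ) y + g.app ((leviCivita g).D y ξ) x := by
  rw [Metric.lieDeriv, dir_app_eq_leviCivita, lie_eq_leviCivita g, lie_eq_leviCivita g,
    g.app_comm x, g.app_comm x, g.app_sub_left, g.app_sub_left]
  ring

end LeviCivita

section Contorsion

variable {E M : Type*} [NormedAddCommGroup E] [NormedSpace ℝ E] [FiniteDimensional ℝ E]
  [TopologicalSpace M] [ChartedSpace E M] [IsManifold 𝓘(ℝ, E) ∞ M] (g : Metric E M)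

namespace LinearConnection

/-- The contorsion of `D` relative to `g`, i.e. the difference tensor
`(x, y, z) ↦ g(D_x y - ∇_x y, z)` to the Levi-Civita connection. -/
noncomputable def contorsion (D : LinearConnection E M) (g : Metric E M) (x y z : 𝔛 E M) : M → ℝ :=
  g.app (D.D x y - (leviCivita g).D x y) z

variable (D : LinearConnection E M)

theorem app_eq_leviCivita_add_contorsion (x y z : 𝔛 E M) :
    g.app (D.D x y) z = g.app ((leviCivita g).D x y) z + D.contorsion g x y z := by
  rw [contorsion, g.app_sub_left]
  ring

theorem eq_of_contorsion_eq [T2Space M] {D D' : LinearConnection E M}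
    (h : D.contorsion g = D'.contorsion g) : D = D' := by
  ext1
  funext x y
  refine g.eq_of_app_eq fun z => ?_
  rw [D.app_eq_leviCivita_add_contorsion g, D'.app_eq_leviCivita_add_contorsion g, h]

theorem torsion₃_eq_contorsion :
    D.torsion₃ g = fun x y z => D.contorsion g x y z - D.contorsion g y x z := by
  funext x y z
  simp only [torsion₃, torsion, contorsion, lie_eq_leviCivita g, g.app_sub_left]
  ring

theorem covMetric_eq_contorsion (x y z : 𝔛 E M) :
    D.covMetric g x y z = -(D.contorsion g x y z + D.contorsion g x z y) := by
  rw [covMetric, dir_app_eq_leviCivita, g.app_comm y, g.app_comm y,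
    D.app_eq_leviCivita_add_contorsion g x y, D.app_eq_leviCivita_add_contorsion g x z]
  ring

end LinearConnection

theorem IsTotallySkew.exists_contorsion_eq [T2Space M] {τ : 𝔛 E M → 𝔛 E M → 𝔛 E M → M → ℝ}
    (hτ : IsTotallySkew τ) (h : ∀ x y : 𝔛 E M, ∃ v : 𝔛 E M, g.app v = τ x y) :
    ∃ D : LinearConnection E M, D.contorsion g = τ := by
  choose V hV using h
  have app_V (x y z : 𝔛 E M) : g.app (V x y) z = g.app (V y z) x := by
    rw [hV, hV, hτ.cyclic]
  -- By `app_V`, linearity of `g` in its first argument makes `V` linear over the smooth functions.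
  have V_add_left (x x' y : 𝔛 E M) : V (x + x') y = V x y + V x' y :=
    g.eq_of_app_eq fun z => by simp only [g.app_add_left, app_V _ y z, g.app_comm (V y z)]
  have V_fmul_left (f : C^∞⟮𝓘(ℝ, E), M; ℝ⟯) (x y : 𝔛 E M) : V (fmul f x) y = fmul f (V x y) :=
    g.eq_of_app_eq fun z => by simp only [g.app_fmul_left, app_V _ y z, g.app_comm (V y z)]
  have V_swap (x y : 𝔛 E M) : V x y = -V y x :=
    g.eq_of_app_eq fun z => by rw [g.app_neg_left, hV, hV, hτ.skew_left]
  let D : LinearConnection E M :=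
    { D := fun x y => (leviCivita g).D x y + V x y
      add_left := fun x x' y => by
        rw [(leviCivita g).add_left, V_add_left]
        abel
      fmul_left := fun f x y => by
        rw [(leviCivita g).fmul_left, V_fmul_left]
        ext1 p
        exact (smul_add _ _ _).symm
      add_right := fun x y y' => by
        rw [(leviCivita g).add_right, V_swap, V_add_left, V_swap x y, V_swap x y']
        abel
      leibniz := fun f x y p => by
        rw [V_swap, V_fmul_left, V_swap x y, ContMDiffSection.coe_add, Pi.add_apply,
          (leviCivita g).leibniz]
        simp [fmul, add_assoc] }
  refine ⟨D, funext fun x => funext fun y => ?_⟩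
  rw [← hV]
  funext z
  simp only [D, LinearConnection.contorsion, add_sub_cancel_left]

end Contorsion

namespace AlmostContactMetric

section Structure

variable {E M : Type*} [NormedAddCommGroup E] [NormedSpace ℝ E] [TopologicalSpace M]
  [ChartedSpace E M] [IsManifold 𝓘(ℝ, E) ∞ M] (S : AlmostContactMetric E M)

theorem φ_app_ξ : S.φ.app S.ξ = 0 := by
  ext1 p
  exact S.φ_ξ p

theorem η_app_φ (x : 𝔛 E M) : S.η.app (S.φ.app x) = 0 :=
  funext fun p => S.η_φ p (x p)

theorem η_app_ξ : S.η.app S.ξ = 1 :=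
  funext S.η_ξ

theorem app_ξ_left (x : 𝔛 E M) : S.g.app S.ξ x = -S.η.app x := by
  funext p
  have h := S.compat p (S.ξ p) (x p)
  rw [S.φ_ξ, S.η_ξ, map_zero, zero_apply, one_mul] at h
  exact eq_neg_of_add_eq_zero_left h.symm

theorem app_ξ_right (x : 𝔛 E M) : S.g.app x S.ξ = -S.η.app x := by
  rw [S.g.app_comm, app_ξ_left]

theorem η_app_eq (x : 𝔛 E M) : S.η.app x = S.g.app (-S.ξ) x := by
  rw [S.g.app_neg_left, app_ξ_left, neg_neg]

theorem app_φ_left (x y : 𝔛 E M) : S.g.app (S.φ.app x) y = -S.g.app x (S.φ.app y) := by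
  funext p
  have h := S.compat p (S.φ p (x p)) (y p)
  have hξ : S.g.val p (S.ξ p) (S.φ p (y p)) = -S.η p (S.φ p (y p)) :=
    congrFun (S.app_ξ_left (S.φ.app y)) p
  rw [S.φ_sq, S.η_φ, map_add, map_neg, map_smul, add_apply, neg_apply, smul_apply, hξ, S.η_φ,
    neg_zero, smul_zero, zero_mul, add_zero, add_zero] at h
  exact h.symm

theorem app_φ_φ_right (x y : 𝔛 E M) :
    S.g.app x (S.φ.app (S.φ.app y)) = -S.g.app x y - S.η.app x * S.η.app y := by
  have h : S.g.app (S.φ.app x) (S.φ.app y) = S.g.app x y + S.η.app x * S.η.app y :=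
    funext fun p => S.compat p (x p) (y p)
  linear_combination S.app_φ_left x (S.φ.app y) - h

end Structure

section CovariantDerivatives

variable {E M : Type*} [NormedAddCommGroup E] [NormedSpace ℝ E] [FiniteDimensional ℝ E]
  [TopologicalSpace M] [ChartedSpace E M] [IsManifold 𝓘(ℝ, E) ∞ M] (S : AlmostContactMetric E M)

theorem φ_app_φ (x : 𝔛 E M) :
    S.φ.app (S.φ.app x) = -x + fmul (S.g.smoothApp (-S.ξ) x) S.ξ := by
  ext1 p
  have hη : S.η p (x p) = S.g.smoothApp (-S.ξ) x p := congrFun (S.η_app_eq x) p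
  change S.φ p (S.φ p (x p)) = -x p + S.g.smoothApp (-S.ξ) x p • S.ξ p
  rw [S.φ_sq, hη]

/-- The tensor `(x, y) ↦ (∇_x η) y`, where `∇` is the Levi-Civita connection of `g`. -/
noncomputable def nablaη (x y : 𝔛 E M) : M → ℝ :=
  (leviCivita S.g).covOneForm S.η x y

theorem nablaη_eq (x y : 𝔛 E M) :
    S.nablaη x y = -S.g.app ((leviCivita S.g).D x S.ξ) y := by
  rw [nablaη, LinearConnection.covOneForm, η_app_eq, η_app_eq, dir_app_eq_leviCivita,
    LinearConnection.neg_right, S.g.app_neg_left]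
  ring

theorem nablaη_ξ_right (x : 𝔛 E M) : S.nablaη x S.ξ = 0 := by
  have dir_one : dir x 1 = 0 := funext fun p => by
    simp only [dir, Pi.one_def, mvfderiv_const, zero_apply, Pi.zero_apply]
  have nablaη_eq_η : S.nablaη x S.ξ = S.η.app ((leviCivita S.g).D x S.ξ) := by
    rw [nablaη_eq, app_ξ_right, neg_neg]
  have nablaη_eq_neg_η : S.nablaη x S.ξ = -S.η.app ((leviCivita S.g).D x S.ξ) := by
    rw [nablaη, LinearConnection.covOneForm, η_app_ξ, dir_one, zero_sub]
  exact self_eq_neg.1 (nablaη_eq_neg_η.trans (by rw [nablaη_eq_η]))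

theorem nablaη_φ_φ_right (x y : 𝔛 E M) :
    S.nablaη x (S.φ.app (S.φ.app y)) = -S.nablaη x y := by
  have hξ := S.nablaη_ξ_right x
  rw [nablaη_eq] at hξ ⊢
  rw [nablaη_eq, app_φ_φ_right]
  rw [app_ξ_right] at hξ
  linear_combination S.η.app y * hξ

theorem nablaη_φ_φ_left (x y : 𝔛 E M) :
    S.nablaη (S.φ.app (S.φ.app x)) y = -S.nablaη x y + S.η.app x * S.nablaη S.ξ y := by
  simp only [nablaη_eq, φ_app_φ, LinearConnection.add_left, LinearConnection.neg_left,
    LinearConnection.fmul_left, S.g.app_add_left, S.g.app_neg_left, S.g.app_fmul_left,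
    Metric.coe_smoothApp, app_ξ_left]
  ring

theorem isKilling_iff : S.g.IsKilling S.ξ ↔ ∀ x y, S.nablaη x y = -S.nablaη y x := by
  refine forall₂_congr fun x y => ?_
  rw [lieDeriv_eq_leviCivita, nablaη_eq, nablaη_eq, neg_inj, add_eq_zero_iff_eq_neg]

theorem F_eq (x y z : 𝔛 E M) :
    S.F x y z = S.g.app ((leviCivita S.g).D x (S.φ.app y)) z
      + S.g.app ((leviCivita S.g).D x y) (S.φ.app z) := by
  rw [F, LinearConnection.covEnd, S.g.app_sub_left, app_φ_left, sub_neg_eq_add]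

theorem F_swap_right (x y z : 𝔛 E M) : S.F x y z = -S.F x z y := by
  have dir_neg (f : M → ℝ) : dir x (-f) = -dir x f := funext fun p => by
    simp only [dir, mvfderiv_neg, neg_apply, Pi.neg_apply]
  have h := congrArg (dir x) (S.app_φ_left y z)
  rw [dir_neg, dir_app_eq_leviCivita, dir_app_eq_leviCivita,
    S.g.app_comm (S.φ.app y), S.g.app_comm y] at h
  rw [F_eq, F_eq]
  linear_combination h

theorem F_ξ_middle (x z : 𝔛 E M) : S.F x S.ξ z = -S.nablaη x (S.φ.app z) := by
  rw [F_eq, φ_app_ξ, LinearConnection.zero_right, S.g.app_zero_left, zero_add, nablaη_eq, neg_neg]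

theorem F_ξ_right (x y : 𝔛 E M) : S.F x y S.ξ = S.nablaη x (S.φ.app y) := by
  rw [F_swap_right, F_ξ_middle, neg_neg]

theorem F_φ_ξ_left (y z : 𝔛 E M) : S.F (S.φ.app S.ξ) y z = 0 := by
  rw [F_eq, φ_app_ξ, LinearConnection.zero_left, LinearConnection.zero_left, S.g.app_zero_left,
    S.g.app_zero_left, add_zero]

theorem F_φ_ξ_right (x y : 𝔛 E M) : S.F x y (S.φ.app S.ξ) = 0 := by
  rw [F, φ_app_ξ, S.g.app_comm, S.g.app_zero_left]

theorem F_φ_φ_right (x y z : 𝔛 E M) :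
    S.F x y (S.φ.app (S.φ.app z)) = -S.F x y z + S.η.app z * S.nablaη x (S.φ.app y) := by
  rw [← F_ξ_right, F, F, F, app_φ_φ_right, app_ξ_right]
  ring

theorem F_φ_middle (x y z : 𝔛 E M) :
    S.F x (S.φ.app y) z = S.F x y (S.φ.app z) - S.nablaη x y * S.η.app z
      - S.η.app y * S.nablaη x z := by
  have dir_η_app : dir x (S.η.app y) = S.nablaη x y + S.η.app ((leviCivita S.g).D x y) := by
    rw [nablaη, LinearConnection.covOneForm, sub_add_cancel]
  have app_φ_φ : S.g.app ((leviCivita S.g).D x (S.φ.app (S.φ.app y))) z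
      = -S.g.app ((leviCivita S.g).D x y) z
        - (S.nablaη x y + S.η.app ((leviCivita S.g).D x y)) * S.η.app z
        - S.η.app y * S.nablaη x z := by
    rw [φ_app_φ, LinearConnection.add_right, LinearConnection.neg_right, S.g.app_add_left,
      S.g.app_neg_left, LinearConnection.app_leibniz, Metric.coe_smoothApp, ← η_app_eq, dir_η_app,
      app_ξ_left, nablaη_eq S x z]
    ring
  rw [F_eq, F_eq, app_φ_φ, app_φ_φ_right]
  ring

theorem F_φ_φ (x y z : 𝔛 E M) :
    S.F x (S.φ.app y) (S.φ.app z) = -S.F x y z + S.η.app z * S.nablaη x (S.φ.app y)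
      - S.η.app y * S.nablaη x (S.φ.app z) := by
  rw [F_φ_middle, F_φ_φ_right, η_app_φ]
  ring

end CovariantDerivatives

section Nijenhuis

variable {E M : Type*} [NormedAddCommGroup E] [NormedSpace ℝ E] [FiniteDimensional ℝ E]
  [TopologicalSpace M] [ChartedSpace E M] [IsManifold 𝓘(ℝ, E) ∞ M] (S : AlmostContactMetric E M)

/-- The obstruction `ψ(x, y, z) = F(x, y, φz) - ((∇_x η) y) η(z)` to the Levi-Civita connection
being natural. The contorsion `K` of a natural connection solves `K(x, y, z) - K(x, φy, φz) = ψ`. -/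
noncomputable def naturalityDefect (x y z : 𝔛 E M) : M → ℝ :=
  S.F x y (S.φ.app z) - S.nablaη x y * S.η.app z

/-- The tensor `P(x, y, z) = F(φx, y, z) + ψ(x, y, z)`. In `x, y`, its alternation is the Nijenhuis
tensor and its symmetrization is, when `ξ` is Killing, the tensor `{φ, φ}`. -/
noncomputable def preNijenhuis (x y z : 𝔛 E M) : M → ℝ :=
  S.F (S.φ.app x) y z + S.naturalityDefect x y z

theorem naturalityDefect_swap_right (x y z : 𝔛 E M) :
    S.naturalityDefect x y z = -S.naturalityDefect x z y := by
  rw [naturalityDefect, naturalityDefect]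
  linear_combination S.F_swap_right x z (S.φ.app y) - S.F_φ_middle x y z

theorem naturalityDefect_ξ_right (x y : 𝔛 E M) : S.naturalityDefect x y S.ξ = -S.nablaη x y := by
  rw [naturalityDefect, F_φ_ξ_right, η_app_ξ, mul_one, zero_sub]

theorem naturalityDefect_φ_right (x y z : 𝔛 E M) :
    S.naturalityDefect x y (S.φ.app z) = -S.F x y z + S.η.app z * S.nablaη x (S.φ.app y) := by
  rw [naturalityDefect, F_φ_φ_right, η_app_φ, mul_zero, sub_zero]

theorem naturalityDefect_φ_φ_left (x y z : 𝔛 E M) :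
    S.naturalityDefect (S.φ.app x) (S.φ.app y) z
      = -S.F (S.φ.app x) y z - S.η.app y * S.nablaη (S.φ.app x) (S.φ.app z) := by
  rw [naturalityDefect, F_φ_φ]
  ring

theorem preNijenhuis_swap_right (x y z : 𝔛 E M) :
    S.preNijenhuis x y z = -S.preNijenhuis x z y := by
  rw [preNijenhuis, preNijenhuis, F_swap_right, naturalityDefect_swap_right, neg_add]

theorem app_bracketφ (x y z : 𝔛 E M) :
    S.g.app (S.bracketφ x y) z = S.F (S.φ.app x) y z - S.F (S.φ.app y) x z
      + S.F x y (S.φ.app z) - S.F y x (S.φ.app z) := by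
  simp only [bracketφ, lie_eq_leviCivita S.g, F, LinearConnection.covEnd, S.g.app_add_left,
    S.g.app_sub_left, app_φ_left]
  ring

theorem app_bracesφ (x y z : 𝔛 E M) :
    S.g.app (S.bracesφ x y) z = S.F (S.φ.app x) y z + S.F (S.φ.app y) x z
      + S.F x y (S.φ.app z) + S.F y x (S.φ.app z) := by
  simp only [bracesφ, braces, F, LinearConnection.covEnd, S.g.app_add_left, S.g.app_sub_left,
    app_φ_left]
  ring

theorem N₃_eq_preNijenhuis :
    S.N₃ = fun x y z => S.preNijenhuis x y z - S.preNijenhuis y x z := by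
  funext x y z
  have N₃_eq : S.N₃ x y z = S.g.app (S.bracketφ x y) z + S.dη x y * S.g.app S.ξ z :=
    funext fun p => by simp [N₃, N, Metric.app]
  rw [N₃_eq, app_bracketφ, app_ξ_left]
  simp only [preNijenhuis, naturalityDefect, dη, nablaη]
  ring

theorem isTotallySkew_N₃_iff : IsTotallySkew S.N₃ ↔ IsTotallySkew S.preNijenhuis := by
  rw [N₃_eq_preNijenhuis]
  exact isTotallySkew_alternation_iff S.preNijenhuis_swap_right

theorem app_bracesφ_of_isKilling (hξ : S.g.IsKilling S.ξ) (x y z : 𝔛 E M) :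
    S.g.app (S.bracesφ x y) z = S.preNijenhuis x y z + S.preNijenhuis y x z := by
  rw [app_bracesφ]
  simp only [preNijenhuis, naturalityDefect]
  linear_combination S.η.app z * S.isKilling_iff.1 hξ x y

theorem Nhat_eq_bracesφ_of_isKilling (hξ : S.g.IsKilling S.ξ) (x y : 𝔛 E M) :
    S.Nhat x y = S.bracesφ x y := by
  funext p
  rw [Nhat, hξ x y, Pi.zero_apply, zero_smul, sub_zero]

variable [T2Space M]

theorem bracesφ_eq_zero_iff_F : (∀ x y, S.bracesφ x y = 0) ↔ ∀ x y z,
    S.F (S.φ.app x) y z + S.F (S.φ.app y) x z + S.F x y (S.φ.app z) + S.F y x (S.φ.app z) = 0 := by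
  simp only [← app_bracesφ]
  exact ⟨fun h x y z => by rw [h, S.g.app_zero_left],
    fun h x y => S.g.eq_zero_of_app_eq_zero (h x y)⟩

theorem isKilling_of_bracesφ_eq_zero (h : ∀ x y, S.bracesφ x y = 0) : S.g.IsKilling S.ξ := by
  have hF := S.bracesφ_eq_zero_iff_F.1 h
  have nablaη_ξ_left (z : 𝔛 E M) : S.nablaη S.ξ z = 0 := by
    have h := hF S.ξ S.ξ z
    rw [F_φ_ξ_left, zero_add, zero_add, F_ξ_middle, nablaη_φ_φ_right, neg_neg] at h
    exact self_eq_neg.1 (eq_neg_of_add_eq_zero_left h)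
  have nablaη_φ_φ (x y : 𝔛 E M) :
      S.nablaη (S.φ.app x) (S.φ.app y) = -S.nablaη (S.φ.app y) (S.φ.app x) := by
    have h := hF x y S.ξ
    rw [F_φ_ξ_right, F_φ_ξ_right, add_zero, add_zero, F_ξ_right, F_ξ_right] at h
    exact eq_neg_of_add_eq_zero_left h
  refine S.isKilling_iff.2 fun x y => ?_
  have h := nablaη_φ_φ (S.φ.app x) (S.φ.app y)
  simp only [nablaη_φ_φ_right, nablaη_φ_φ_left, nablaη_ξ_left] at h
  linear_combination h

theorem bracesφ_eq_zero_iff_preNijenhuis (hξ : S.g.IsKilling S.ξ) :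
    (∀ x y, S.bracesφ x y = 0) ↔ IsTotallySkew S.preNijenhuis := by
  refine ⟨fun h => ⟨fun x y z => ?_, S.preNijenhuis_swap_right⟩, fun h x y => ?_⟩
  · rw [← add_eq_zero_iff_eq_neg, ← S.app_bracesφ_of_isKilling hξ, h, S.g.app_zero_left]
  · refine S.g.eq_zero_of_app_eq_zero fun z => ?_
    rw [S.app_bracesφ_of_isKilling hξ, h.skew_left, neg_add_cancel]

end Nijenhuis

section NaturalConnections

variable {E M : Type*} [NormedAddCommGroup E] [NormedSpace ℝ E] [FiniteDimensional ℝ E]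
  [TopologicalSpace M] [ChartedSpace E M] [IsManifold 𝓘(ℝ, E) ∞ M] (S : AlmostContactMetric E M)
  {D : LinearConnection E M}

theorem app_D_ξ (D : LinearConnection E M) (x y : 𝔛 E M) :
    S.g.app (D.D x S.ξ) y = -S.nablaη x y + D.contorsion S.g x S.ξ y := by
  rw [D.app_eq_leviCivita_add_contorsion, nablaη_eq, neg_neg]

theorem covOneForm_η_eq (D : LinearConnection E M) (x y : 𝔛 E M) :
    D.covOneForm S.η x y = S.nablaη x y + D.contorsion S.g x y S.ξ := by
  rw [nablaη, LinearConnection.contorsion, S.g.app_sub_left, app_ξ_right, app_ξ_right,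
    LinearConnection.covOneForm, LinearConnection.covOneForm]
  ring

theorem app_covEnd_φ (D : LinearConnection E M) (x y z : 𝔛 E M) :
    S.g.app (D.covEnd S.φ x y) z = S.F x y z + D.contorsion S.g x (S.φ.app y) z
      + D.contorsion S.g x y (S.φ.app z) := by
  rw [LinearConnection.covEnd, S.g.app_sub_left, app_φ_left, F_eq,
    D.app_eq_leviCivita_add_contorsion, D.app_eq_leviCivita_add_contorsion]
  ring

theorem contorsion_φ_φ_right (D : LinearConnection E M) (x y z : 𝔛 E M) :
    D.contorsion S.g x y (S.φ.app (S.φ.app z))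
      = -D.contorsion S.g x y z + S.η.app z * D.contorsion S.g x y S.ξ := by
  simp only [LinearConnection.contorsion, app_φ_φ_right, app_ξ_right]
  ring

variable {S}

theorem IsNatural.contorsion_swap_right (hD : S.IsNatural D) (x y z : 𝔛 E M) :
    D.contorsion S.g x y z = -D.contorsion S.g x z y := by
  have h := hD.g_parallel x y z
  rw [D.covMetric_eq_contorsion, neg_eq_zero] at h
  exact eq_neg_of_add_eq_zero_left h

theorem IsNatural.contorsion_ξ_right (hD : S.IsNatural D) (x y : 𝔛 E M) :
    D.contorsion S.g x y S.ξ = -S.nablaη x y := by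
  have h := hD.η_parallel x y
  rw [covOneForm_η_eq] at h
  exact eq_neg_of_add_eq_zero_right h

theorem IsNatural.F_eq_contorsion (hD : S.IsNatural D) (x y z : 𝔛 E M) :
    S.F x y z = -D.contorsion S.g x (S.φ.app y) z - D.contorsion S.g x y (S.φ.app z) := by
  have h := S.app_covEnd_φ D x y z
  rw [hD.φ_parallel, S.g.app_zero_left] at h
  linear_combination -h

theorem IsNatural.naturalityDefect_eq_contorsion (hD : S.IsNatural D) (x y z : 𝔛 E M) :
    S.naturalityDefect x y z
      = D.contorsion S.g x y z - D.contorsion S.g x (S.φ.app y) (S.φ.app z) := by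
  rw [naturalityDefect, hD.F_eq_contorsion, contorsion_φ_φ_right, hD.contorsion_ξ_right]
  ring

theorem isNatural_of_contorsion [T2Space M]
    (hK : ∀ x y z, D.contorsion S.g x y z = -D.contorsion S.g x z y)
    (hψ : ∀ x y z, S.naturalityDefect x y z
      = D.contorsion S.g x y z - D.contorsion S.g x (S.φ.app y) (S.φ.app z)) :
    S.IsNatural D := by
  have contorsion_ξ_right (x y : 𝔛 E M) : D.contorsion S.g x y S.ξ = -S.nablaη x y := by
    have contorsion_zero (w : 𝔛 E M) : D.contorsion S.g x w 0 = 0 := by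
      rw [LinearConnection.contorsion, S.g.app_comm, S.g.app_zero_left]
    rw [← naturalityDefect_ξ_right, hψ, φ_app_ξ, contorsion_zero, sub_zero]
  refine ⟨fun x y => S.g.eq_zero_of_app_eq_zero fun z => ?_,
    fun x => S.g.eq_zero_of_app_eq_zero fun y => ?_, fun x y => ?_, fun x y z => ?_⟩
  · have h := hψ x y (S.φ.app z)
    rw [naturalityDefect_φ_right, contorsion_φ_φ_right, contorsion_ξ_right] at h
    rw [app_covEnd_φ]
    linear_combination -h
  · rw [app_D_ξ, hK, contorsion_ξ_right]
    ring
  · rw [covOneForm_η_eq, contorsion_ξ_right, add_neg_cancel]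
  · rw [D.covMetric_eq_contorsion, hK, neg_add_cancel, neg_zero]

end NaturalConnections

section SkewTorsion

variable {E M : Type*} [NormedAddCommGroup E] [NormedSpace ℝ E] [FiniteDimensional ℝ E]
  [TopologicalSpace M] [ChartedSpace E M] [IsManifold 𝓘(ℝ, E) ∞ M] {S : AlmostContactMetric E M}
  {D : LinearConnection E M}

theorem IsNatural.isTotallySkew_torsion₃_iff (hD : S.IsNatural D) :
    IsTotallySkew (D.torsion₃ S.g) ↔ IsTotallySkew (D.contorsion S.g) := by
  rw [D.torsion₃_eq_contorsion]
  exact isTotallySkew_alternation_iff hD.contorsion_swap_right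

theorem IsNatural.isKilling (hD : S.IsNatural D) (hK : IsTotallySkew (D.contorsion S.g)) :
    S.g.IsKilling S.ξ := by
  refine S.isKilling_iff.2 fun x y => ?_
  linear_combination hD.contorsion_ξ_right x y + hD.contorsion_ξ_right y x
    - hK.skew_left x y S.ξ

theorem IsNatural.preNijenhuis_eq_contorsion (hD : S.IsNatural D) (x y z : 𝔛 E M) :
    S.preNijenhuis x y z = D.contorsion S.g x y z
      - (D.contorsion S.g (S.φ.app x) (S.φ.app y) z + D.contorsion S.g (S.φ.app x) y (S.φ.app z)
        + D.contorsion S.g x (S.φ.app y) (S.φ.app z)) := by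
  rw [preNijenhuis, hD.F_eq_contorsion, hD.naturalityDefect_eq_contorsion]
  ring

theorem IsNatural.isTotallySkew_preNijenhuis (hD : S.IsNatural D)
    (hK : IsTotallySkew (D.contorsion S.g)) : IsTotallySkew S.preNijenhuis := by
  refine ⟨fun x y z => ?_, S.preNijenhuis_swap_right⟩
  rw [hD.preNijenhuis_eq_contorsion, hD.preNijenhuis_eq_contorsion]
  linear_combination hK.skew_left x y z - hK.skew_left (S.φ.app x) (S.φ.app y) z
    - hK.skew_left (S.φ.app x) y (S.φ.app z) - hK.skew_left x (S.φ.app y) (S.φ.app z)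

variable (S) in
/-- The torsion `(x, y, z) ↦ ψ(x, y, z) - ψ(y, x, z) - F(φz, x, y)` of the natural connection with
totally skew-symmetric torsion. -/
noncomputable def skewTorsion (x y z : 𝔛 E M) : M → ℝ :=
  S.naturalityDefect x y z - S.naturalityDefect y x z - S.F (S.φ.app z) x y

theorem IsNatural.two_mul_contorsion (hD : S.IsNatural D)
    (hK : IsTotallySkew (D.contorsion S.g)) (x y z : 𝔛 E M) :
    2 * D.contorsion S.g x y z = S.skewTorsion x y z := by
  rw [skewTorsion, hD.naturalityDefect_eq_contorsion, hD.naturalityDefect_eq_contorsion,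
    hD.F_eq_contorsion]
  linear_combination hK.skew_left x y z - hK.cyclic (S.φ.app z) x (S.φ.app y)
    - hK.cyclic (S.φ.app z) (S.φ.app x) y - hK.skew_left (S.φ.app x) y (S.φ.app z)

theorem skewTorsion_eq_cyclicSum_sub (hP : IsTotallySkew S.preNijenhuis) :
    S.skewTorsion = fun x y z => S.naturalityDefect x y z + S.naturalityDefect y z x
      + S.naturalityDefect z x y - S.preNijenhuis x y z := by
  funext x y z
  rw [← hP.cyclic z x y, preNijenhuis, skewTorsion, S.naturalityDefect_swap_right y x z]
  ring

theorem isTotallySkew_skewTorsion (hP : IsTotallySkew S.preNijenhuis) :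
    IsTotallySkew S.skewTorsion := by
  rw [skewTorsion_eq_cyclicSum_sub hP]
  exact (isTotallySkew_cyclicSum S.naturalityDefect_swap_right).sub hP

theorem skewTorsion_φ_φ (hP : IsTotallySkew S.preNijenhuis) (hξ : S.g.IsKilling S.ξ)
    (x y z : 𝔛 E M) :
    S.skewTorsion x (S.φ.app y) (S.φ.app z)
      = S.F (S.φ.app x) y z - S.F (S.φ.app y) z x - S.F (S.φ.app z) x y := by
  have hη := S.isKilling_iff.1 hξ
  rw [(isTotallySkew_skewTorsion hP).cyclic, skewTorsion, naturalityDefect_φ_φ_left,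
    naturalityDefect_φ_φ_left, F_φ_φ]
  linear_combination S.F_swap_right (S.φ.app z) y x - S.η.app z * hη (S.φ.app x) (S.φ.app y)
    + S.η.app y * hη (S.φ.app x) (S.φ.app z)

theorem two_mul_naturalityDefect (hP : IsTotallySkew S.preNijenhuis) (hξ : S.g.IsKilling S.ξ)
    (x y z : 𝔛 E M) :
    2 * S.naturalityDefect x y z
      = S.skewTorsion x y z - S.skewTorsion x (S.φ.app y) (S.φ.app z) := by
  have h := hP.cyclic x y z
  rw [preNijenhuis, preNijenhuis] at h
  rw [skewTorsion_φ_φ hP hξ, skewTorsion]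
  linear_combination h + S.naturalityDefect_swap_right y x z

theorem exists_dual_skewTorsion (S : AlmostContactMetric E M) (x y : 𝔛 E M) :
    ∃ v : 𝔛 E M, S.g.app v = S.skewTorsion x y := by
  obtain ⟨v, hv⟩ := exists_dual_leviCivita_left S.g (S.φ.app x) y
  obtain ⟨w, hw⟩ := exists_dual_leviCivita_left S.g x (S.φ.app y)
  let nablaφ := (leviCivita S.g).covEnd S.φ
  let nablaξ := fun u => (leviCivita S.g).D u S.ξ
  refine ⟨S.φ.app (nablaφ y x - nablaφ x y + v + w) + (fmul (S.g.smoothApp (nablaξ y) x) S.ξ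
    - fmul (S.g.smoothApp (nablaξ x) y) S.ξ), funext fun z => ?_⟩
  simp only [nablaφ, nablaξ, S.g.app_add_left, S.g.app_sub_left, S.g.app_fmul_left, app_φ_left, hv,
    hw, Metric.coe_smoothApp, app_ξ_left]
  rw [skewTorsion, F_eq S (S.φ.app z), naturalityDefect, naturalityDefect, nablaη_eq, nablaη_eq,
    F, F]
  ring

variable [T2Space M]

theorem exists_isNatural (hP : IsTotallySkew S.preNijenhuis) (hξ : S.g.IsKilling S.ξ) :
    ∃ D : LinearConnection E M, S.IsNatural D ∧ IsTotallySkew (D.contorsion S.g) := by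
  have hτ := (isTotallySkew_skewTorsion hP).smul 2⁻¹
  obtain ⟨D, hD⟩ := hτ.exists_contorsion_eq S.g fun x y => by
    obtain ⟨v, hv⟩ := S.exists_dual_skewTorsion x y
    exact ⟨(2⁻¹ : ℝ) • v, funext fun z => by rw [S.g.app_smul_left, hv]⟩
  rw [← hD] at hτ
  refine ⟨D, isNatural_of_contorsion hτ.skew_right fun x y z => ?_, hτ⟩
  rw [hD, ← smul_sub, ← two_mul_naturalityDefect hP hξ]
  funext p
  simp

theorem IsNatural.eq_of_isTotallySkew {D' : LinearConnection E M} (hD : S.IsNatural D)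
    (hD' : S.IsNatural D') (hK : IsTotallySkew (D.contorsion S.g))
    (hK' : IsTotallySkew (D'.contorsion S.g)) : D = D' := by
  refine LinearConnection.eq_of_contorsion_eq S.g (funext₃ fun x y z => funext fun p => ?_)
  have h := congrFun (hD.two_mul_contorsion hK x y z |>.trans
    (hD'.two_mul_contorsion hK' x y z).symm) p
  exact mul_left_cancel₀ two_ne_zero h

theorem existsUnique_isNatural_iff (S : AlmostContactMetric E M) :
    (∃! D : LinearConnection E M, S.IsNatural D ∧ IsTotallySkew (D.torsion₃ S.g)) ↔
      IsTotallySkew S.preNijenhuis ∧ S.g.IsKilling S.ξ := by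
  constructor
  · rintro ⟨D, ⟨hD, hT⟩, -⟩
    have hK := hD.isTotallySkew_torsion₃_iff.1 hT
    exact ⟨hD.isTotallySkew_preNijenhuis hK, hD.isKilling hK⟩
  · rintro ⟨hP, hξ⟩
    obtain ⟨D, hD, hK⟩ := exists_isNatural hP hξ
    refine ⟨D, ⟨hD, hD.isTotallySkew_torsion₃_iff.2 hK⟩, fun D' ⟨hD', hT'⟩ => ?_⟩
    exact hD'.eq_of_isTotallySkew hD (hD'.isTotallySkew_torsion₃_iff.1 hT') hK

end SkewTorsion

end AlmostContactMetric

end PseudoRiemannian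

/-- On a pseudo-Riemannian manifold with an almost contact metric structure, the `F`-identity of the
class, the two conditions on the associated Nijenhuis tensor, the condition on the Nijenhuis tensor,
and the unique existence of a natural connection with totally skew-symmetric torsion are
equivalent. -/
theorem theorem8 {E M : Type*} [NormedAddCommGroup E] [NormedSpace ℝ E] [FiniteDimensional ℝ E]
    [TopologicalSpace M] [ChartedSpace E M] [IsManifold 𝓘(ℝ, E) ∞ M] [T2Space M]
    (S : PseudoRiemannian.AlmostContactMetric E M) :
    List.TFAE [
      ∀ x y z : PseudoRiemannian.𝔛 E M,
        S.F (S.φ.app x) y z + S.F (S.φ.app y) x z + S.F x y (S.φ.app z) + S.F y x (S.φ.app z) = 0,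
      (∀ (x y : PseudoRiemannian.𝔛 E M) (p : M), S.Nhat x y p = 0) ∧ S.g.IsKilling S.ξ,
      (∀ x y : PseudoRiemannian.𝔛 E M, S.bracesφ x y = 0) ∧ S.g.IsKilling S.ξ,
      PseudoRiemannian.IsTotallySkew S.N₃ ∧ S.g.IsKilling S.ξ,
      ∃! D : PseudoRiemannian.LinearConnection E M,
        S.IsNatural D ∧ PseudoRiemannian.IsTotallySkew (D.torsion₃ S.g)] := by
  tfae_have 1 ↔ 3 := by
    rw [← S.bracesφ_eq_zero_iff_F]
    exact ⟨fun h => ⟨h, S.isKilling_of_bracesφ_eq_zero h⟩, And.left⟩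
  tfae_have 2 ↔ 3 := and_congr_left fun hξ => forall₂_congr fun x y => by
    rw [S.Nhat_eq_bracesφ_of_isKilling hξ, ContMDiffSection.ext_iff]
    rfl
  tfae_have 3 ↔ 4 := and_congr_left fun hξ =>
    (S.bracesφ_eq_zero_iff_preNijenhuis hξ).trans S.isTotallySkew_N₃_iff.symm
  tfae_have 5 ↔ 4 := by
    rw [S.existsUnique_isNatural_iff, S.isTotallySkew_N₃_iff]
  tfae_finish
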